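/- Let $\phi,\delta,\phi_0,\delta_0>0$ with $\delta+\delta_0<1$ and $\phi^2<1/2$. For each sample size $T$ let $p=p_T$ and $s=s_T$ be integers with $\log p=\phi T^{\delta}$ and $s=\phi_0T^{\delta_0}$, up to rounding of $\exp(\phi T^\delta)$ and $\phi_0T^{\delta_0}$ to an adjacent integer. Let $$X=R_X^{1/2}\,Z_X\,\Sigma_X^{1/2}\in\mathbb{R}^{T\times p},$$ and let $R_u\in\mathbb{R}^{T\times T}$, where the following hold. (a) The entries of $Z_X\in\mathbb{R}^{T\times p}$ and of $z_u\in\mathbb{R}^T$ are jointly i.i.d. standard normal. (b) $R_X,R_u\in\mathbb{R}^{T\times T}$ and $\Sigma_X\in\mathbb{R}^{p\times p}$ are non-random, symmetric and positive definite, with minimum eigenvalues at least $c_{R_X}>0$, $c_{R_u}>0$ and $c_\Sigma>0$ respectively (constants not depending on $T$); put $c_R=\min(c_{R_X},c_{R_u})$. (c) $R_X^{1/2}$ and $R_u^{1/2}$ are lower triangular Cholesky factors ($R^{1/2}(R^{1/2})^\top=R$) with unit diagonal, and for each $s$ the sum of squares of their $s$-th row is $O(1)$ as $T\to\infty$; $\Sigma_X^{1/2}$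 is a positive definite (not necessarily symmetric) matrix with $(\Sigma_X^{1/2})^\top\Sigma_X^{1/2}=\Sigma_X$ and unit diagonal, and for each $j$ the sum of squares of its $j$-th column is bounded in $T$. Let $m=m_T$ be nonnegative integers with $m\le\phi T^{1-\delta}$, let $\gamma=c_\Sigma c_R/9$ and $c_2=1/2-\phi^2$, and let $$\mathcal{E}_2=\Bigl\{\min_{v\in\mathbb{R}^p,\ v\ne0,\ \|v\|_0\le m}\frac{T^{-1}\|Xv\|_2^2}{\|v\|_2^2}\ge\gamma\Bigr\},$$ where $\|v\|_0$ is the number of nonzero coordinates of $v$ (if $m=0$ the condition is void). Then there is a $T_0$, depending only on $\phi$ and $\delta$, such that for all $T\ge T_0$ $$P(\mathcal{E}_2^c)\le 2\exp(-c_2T).$$ In particular, if $m\to\infty$, the restricted strong convexity assumption holds with these constants for every penalty whose curvature constant $\mu$ satisfies $\mu<2\gamma$: $m$ diverges, $m=o(T)$, $c_2>0$, $\gamma>0$, $\gamma>\mu/2$, and $P(\mathcal{E}_2^c)=O(\exp(-c_2T))$. -/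

import Mathlib

open MeasureTheory ProbabilityTheory Filter Asymptotics
open scoped Matrix

/-- Squared Euclidean norm `‖v‖₂²` of a coordinate vector. -/
def sqNorm {n : ℕ} (v : Fin n → ℝ) : ℝ := ∑ i, v i ^ 2

/-- `‖v‖₀`, the number of nonzero coordinates. -/
noncomputable def zeroNorm {n : ℕ} (v : Fin n → ℝ) : ℕ :=
  (Finset.univ.filter fun i => v i ≠ 0).card

/-- The sparse restricted-eigenvalue event: the minimum of `T⁻¹ ‖X v‖₂² / ‖v‖₂²` over the nonzero
vectors `v` with `‖v‖₀ ≤ m` is at least `γ`. -/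
def sparseEigEvent {Ω : Type*} {T p : ℕ} (X : Ω → Matrix (Fin T) (Fin p) ℝ) (m : ℕ) (γ : ℝ) :
    Set Ω :=
  {ω | ∀ v : Fin p → ℝ, v ≠ 0 → zeroNorm v ≤ m →
    γ ≤ (T : ℝ)⁻¹ * sqNorm (X ω *ᵥ v) / sqNorm v}

/-- Restricted strong convexity with sparsity levels `m T`, constants `c₂`, `γ`, and penalty
curvature `μ`: `m` diverges, `m = o(T)`, `c₂ > 0`, `γ > 0`, `γ > μ / 2`, and the complement of the
sparse restricted-eigenvalue event has probability `O(exp(-c₂ T))`. -/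
structure RestrictedStrongConvexity {Ω : Type*} [MeasurableSpace Ω] (P : Measure Ω) {p : ℕ → ℕ}
    (X : ∀ T, Ω → Matrix (Fin T) (Fin (p T)) ℝ) (m : ℕ → ℕ) (μ c₂ γ : ℝ) : Prop where
  diverges : Tendsto m atTop atTop
  littleO : (fun T => (m T : ℝ)) =o[atTop] (fun T : ℕ => (T : ℝ))
  c₂_pos : 0 < c₂
  γ_pos : 0 < γ
  curvature_lt : μ / 2 < γ
  bigO : (fun T => P.real (sparseEigEvent (X T) (m T) γ)ᶜ) =O[atTop]
    (fun T : ℕ => Real.exp (-c₂ * T))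

/-- Dimensionality: `log p = φ T ^ δ` and `s = φ₀ T ^ δ₀` with positive constants and
`δ + δ₀ < 1`. As `p` and `s` are integers, `p` and `s` are allowed to be any rounding
(up, down or to nearest) of `exp (φ T ^ δ)` and `φ₀ T ^ δ₀`. -/
structure Dimensionality (p s : ℕ → ℕ) (φ δ φ₀ δ₀ : ℝ) : Prop where
  φ_pos : 0 < φ
  δ_pos : 0 < δ
  φ₀_pos : 0 < φ₀
  δ₀_pos : 0 < δ₀
  add_lt_one : δ + δ₀ < 1
  p_eq : ∀ T : ℕ, 1 ≤ T → |(p T : ℝ) - Real.exp (φ * (T : ℝ) ^ δ)| < 1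
  s_eq : ∀ T : ℕ, 1 ≤ T → |(s T : ℝ) - φ₀ * (T : ℝ) ^ δ₀| < 1

/-- The entries of the matrix `Z` and of the vector `z`, as one family of random variables. -/
def noiseEntries {Ω : Type*} {T p : ℕ} (Z : Ω → Matrix (Fin T) (Fin p) ℝ) (z : Ω → Fin T → ℝ) :
    (Fin T × Fin p) ⊕ Fin T → Ω → ℝ :=
  Sum.elim (fun a ω => Z ω a.1 a.2) (fun t ω => z ω t)

/-- A (Cholesky) square root `L` of the temporal covariance matrices `R T`, for each `T`: the
`R T` are symmetric positive definite with eigenvalues at least `c > 0`, and `R T = L T (L T)ᵀ`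
with `L T` lower triangular with unit diagonal, whose `s`-th row has a sum of squares that is
bounded in `T`, for each `s`. -/
structure TemporalRoot (R L : ∀ T : ℕ, Matrix (Fin T) (Fin T) ℝ) (c : ℝ) : Prop where
  c_pos : 0 < c
  posDef : ∀ T, (R T).PosDef
  le_eigenvalue : ∀ T, ∀ a ∈ spectrum ℝ (R T), c ≤ a
  root : ∀ T, L T * (L T)ᵀ = R T
  lower : ∀ T (i j : Fin T), i < j → L T i j = 0
  diag : ∀ T (i : Fin T), L T i i = 1
  row_bound : ∀ s : ℕ, ∃ C : ℝ, ∀ T (h : s < T), ∑ t, L T ⟨s, h⟩ t ^ 2 ≤ C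

/-- A square root `S T` of the cross-sectional covariance matrices `V T`: the `V T` are symmetric
positive definite with eigenvalues at least `c > 0`, `(S T)ᵀ * S T = V T`, and `S T` is positive
definite with unit diagonal, with the sum of squares of the `j`-th column bounded in `T`, for each
`j`. Symmetry of `S T` is not imposed, so that the symmetric root is included (then
`S T * S T = V T`) as well as other roots. -/
structure CrossRoot {p : ℕ → ℕ} (V S : ∀ T, Matrix (Fin (p T)) (Fin (p T)) ℝ) (c : ℝ) : Prop where
  c_pos : 0 < c
  posDef : ∀ T, (V T).PosDef
  le_eigenvalue : ∀ T, ∀ a ∈ spectrum ℝ (V T), c ≤ a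
  root : ∀ T, (S T)ᵀ * S T = V T
  pos : ∀ T (v : Fin (p T) → ℝ), v ≠ 0 → 0 < v ⬝ᵥ (S T *ᵥ v)
  diag : ∀ T (i : Fin (p T)), S T i i = 1
  col_bound : ∀ j : ℕ, ∃ C : ℝ, ∀ T (h : j < p T), ∑ i, S T i ⟨j, h⟩ ^ 2 ≤ C

/-- The Gaussian time-series design: `Z T` and `z T` have jointly i.i.d. standard normal entries,
and the covariance matrices and their square roots are as described above. -/
structure GaussianDesign {Ω : Type*} [MeasurableSpace Ω] (P : Measure Ω) {p : ℕ → ℕ}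
    (Z : ∀ T, Ω → Matrix (Fin T) (Fin (p T)) ℝ) (z : ∀ T, Ω → Fin T → ℝ)
    (RX LX Ru Lu : ∀ T : ℕ, Matrix (Fin T) (Fin T) ℝ)
    (V S : ∀ T, Matrix (Fin (p T)) (Fin (p T)) ℝ) (cRX cRu cV : ℝ) : Prop where
  gaussian : ∀ T k, HasLaw (noiseEntries (Z T) (z T) k) (gaussianReal 0 1) P
  indep : ∀ T, iIndepFun (noiseEntries (Z T) (z T)) P
  rootX : TemporalRoot RX LX cRX
  rootu : TemporalRoot Ru Lu cRu
  rootV : CrossRoot V S cV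

/-- The covariate matrix `X = R_X^{1/2} Z_X Σ_X^{1/2}`. -/
def covariate {Ω : Type*} {p : ℕ → ℕ} (LX : ∀ T : ℕ, Matrix (Fin T) (Fin T) ℝ)
    (Z : ∀ T, Ω → Matrix (Fin T) (Fin (p T)) ℝ)
    (S : ∀ T, Matrix (Fin (p T)) (Fin (p T)) ℝ) (T : ℕ) (ω : Ω) :
    Matrix (Fin T) (Fin (p T)) ℝ :=
  LX T * Z T ω * S T

/-! For a fixed vector `x`, the entries of `Z x / ‖x‖₂` are i.i.d. standard normal, so `‖Z x‖² /
‖x‖²` is chi-squared with `T` degrees of freedom. Chernoff bounds place it outside `(0.15 T, 4 T)`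
with probability at most `exp (-0.52 T)` on each side.

On a subspace of dimension at most `m`, a cubic grid of at most `(100 m + 1) ^ m` points reduces the
uniform lower bound to fixed vectors: the lower tail is applied at grid points and the upper tail at
an orthonormal basis, which controls the rounding error (`le_norm_map_of_grid`). This gives `‖Z w‖²
≥ (T / 9) ‖w‖²` on the whole subspace.

Sparse vectors lie in at most `p ^ m` coordinate subspaces, whose images under `Σ_X^{1/2}` still
have dimension at most `m`; the two outer factors cost only their smallest eigenvalues. Since `m log
p ≤ φ² T` and `m log T` is negligible against `T`, the union bound costs `exp (φ² T + 0.02 T)` up to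
a factor 2, leaving the rate `1/2 - φ²`. -/

/-! ### Chi-squared tails -/

/-- The moment-generating function of the square of a standard Gaussian variable. -/
theorem mgf_sq_of_hasLaw_gaussianReal {Ω : Type*} [MeasurableSpace Ω] {P : Measure Ω}
    {Y : Ω → ℝ} (hY : HasLaw Y (gaussianReal 0 1) P) {t : ℝ} (ht : t < 1 / 2) :
    mgf (fun ω => Y ω ^ 2) P t = (√(1 - 2 * t))⁻¹ := by
  have h1 : mgf (fun ω => Y ω ^ 2) P t = ∫ x, Real.exp (t * x ^ 2) ∂(gaussianReal 0 1) := by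
    rw [← hY.integral_comp (by fun_prop)]
    rfl
  rw [h1, integral_gaussianReal_eq_integral_smul one_ne_zero]
  have h2 : ∀ x : ℝ, gaussianPDFReal 0 1 x • Real.exp (t * x ^ 2)
      = (√(2 * Real.pi))⁻¹ * Real.exp (-(1 / 2 - t) * x ^ 2) := by
    intro x
    rw [gaussianPDFReal_def, smul_eq_mul, mul_assoc, ← Real.exp_add]
    simp only [NNReal.coe_one, mul_one, sub_zero]
    congr 2
    ring
  simp_rw [h2]
  rw [integral_const_mul, integral_gaussian, ← Real.sqrt_inv, ← Real.sqrt_inv, ← Real.sqrt_mul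
    (by positivity)]
  congr 1
  have : (1 / 2 - t) ≠ 0 := by linarith
  have : (1 - 2 * t) ≠ 0 := by linarith
  have := Real.pi_pos.ne'
  field_simp

/-- The moment-generating function of a sum of squares of independent standard Gaussian
variables. -/
theorem mgf_sum_sq_of_gaussianReal {Ω : Type*} [MeasurableSpace Ω] {P : Measure Ω} {n : ℕ}
    {Y : Fin n → Ω → ℝ} (hY : ∀ i, HasLaw (Y i) (gaussianReal 0 1) P) (hind : iIndepFun Y P)
    {t : ℝ} (ht : t < 1 / 2) :
    mgf (fun ω => ∑ i, Y i ω ^ 2) P t = (√(1 - 2 * t))⁻¹ ^ n := by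
  have hind' : iIndepFun (fun i ω => Y i ω ^ 2) P :=
    hind.comp (fun _ x => x ^ 2) (fun _ => by fun_prop)
  have h := hind'.mgf_sum₀ (t := t) (fun i => (hY i).aemeasurable.pow_const 2) Finset.univ
  simp_rw [mgf_sq_of_hasLaw_gaussianReal (hY _) ht] at h
  rw [Finset.prod_const, Finset.card_univ, Fintype.card_fin] at h
  rw [← h]
  congr 1
  ext ω
  simp

theorem integrable_exp_mul_sum_sq_of_gaussianReal {Ω : Type*} [MeasurableSpace Ω] {P : Measure Ω}
    [IsProbabilityMeasure P] {n : ℕ}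
    {Y : Fin n → Ω → ℝ} (hY : ∀ i, HasLaw (Y i) (gaussianReal 0 1) P) (hind : iIndepFun Y P)
    {t : ℝ} (ht : t < 1 / 2) :
    Integrable (fun ω => Real.exp (t * ∑ i, Y i ω ^ 2)) P := by
  have : 0 < 1 - 2 * t := by linarith
  rw [← mgf_pos_iff, mgf_sum_sq_of_gaussianReal hY hind ht]
  positivity

/-- Lower tail of a chi-squared variable. -/
theorem measure_sum_sq_gaussianReal_le {Ω : Type*} [MeasurableSpace Ω] {P : Measure Ω}
    [IsProbabilityMeasure P] {n : ℕ}
    {Y : Fin n → Ω → ℝ} (hY : ∀ i, HasLaw (Y i) (gaussianReal 0 1) P) (hind : iIndepFun Y P) :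
    P.real {ω | ∑ i, Y i ω ^ 2 ≤ 0.15 * n} ≤ Real.exp (-0.52 * n) := by
  -- The optimal Chernoff parameter solves `1 - 2 * t = 1 / 0.15`, so `t ≈ -2.83`; `-3` already
  -- suffices and gives `exp 0.45 / √7` per degree of freedom.
  refine (measure_le_le_exp_mul_mgf (t := -3) _ (by norm_num)
    (integrable_exp_mul_sum_sq_of_gaussianReal hY hind (by norm_num))).trans ?_
  rw [mgf_sum_sq_of_gaussianReal hY hind (by norm_num),
    show -(-3) * (0.15 * (n : ℝ)) = n * 0.45 by ring, show -0.52 * (n : ℝ) = n * (-0.52) by ring,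
    Real.exp_nat_mul, Real.exp_nat_mul, ← mul_pow]
  refine pow_le_pow_left₀ (by positivity) ?_ n
  rw [← div_eq_mul_inv, div_le_iff₀ (by norm_num), ← div_le_iff₀' (Real.exp_pos _),
    ← Real.exp_sub]
  refine Real.le_sqrt_of_sq_le ?_
  rw [← Real.exp_nat_mul]
  -- What remains is `exp 1.94 ≤ 7`; the 50th power makes the exponent an integer, so that a decimal
  -- bound on `e` decides it.
  refine le_of_pow_le_pow_left₀ (n := 50) (by norm_num) (by norm_num) ?_
  rw [← Real.exp_nat_mul]
  have h : Real.exp (((50 : ℕ) : ℝ) * (((2 : ℕ) : ℝ) * (0.45 - -0.52))) = Real.exp 1 ^ 97 := by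
    rw [← Real.exp_nat_mul]; norm_num
  rw [h]
  exact (pow_le_pow_left₀ (Real.exp_pos _).le Real.exp_one_lt_d9.le 97).trans (by norm_num)

/-- Upper tail of a chi-squared variable. -/
theorem measure_le_sum_sq_gaussianReal {Ω : Type*} [MeasurableSpace Ω] {P : Measure Ω}
    [IsProbabilityMeasure P] {n : ℕ}
    {Y : Fin n → Ω → ℝ} (hY : ∀ i, HasLaw (Y i) (gaussianReal 0 1) P) (hind : iIndepFun Y P) :
    P.real {ω | 4 * n ≤ ∑ i, Y i ω ^ 2} ≤ Real.exp (-0.52 * n) := by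
  refine (measure_ge_le_exp_mul_mgf (t := 1 / 4) _ (by norm_num)
    (integrable_exp_mul_sum_sq_of_gaussianReal hY hind (by norm_num))).trans ?_
  rw [mgf_sum_sq_of_gaussianReal hY hind (by norm_num),
    show -(1 / 4) * (4 * (n : ℝ)) = n * (-1) by ring, show -0.52 * (n : ℝ) = n * (-0.52) by ring,
    Real.exp_nat_mul, Real.exp_nat_mul, ← mul_pow]
  refine pow_le_pow_left₀ (by positivity) ?_ n
  rw [← div_eq_mul_inv, div_le_iff₀ (by norm_num), ← div_le_iff₀' (Real.exp_pos _),
    ← Real.exp_sub]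
  refine Real.le_sqrt_of_sq_le ?_
  rw [← Real.exp_nat_mul, ← inv_inv (Real.exp _), ← Real.exp_neg]
  refine inv_le_of_inv_le₀ (by norm_num) ?_
  have := Real.quadratic_le_exp_of_nonneg (x := 0.96) (by norm_num)
  norm_num at this ⊢
  linarith

/-! ### A Gaussian matrix applied to a fixed vector -/

section GaussianMatrix

variable {Ω : Type*} [MeasurableSpace Ω] {P : Measure Ω} {n p : ℕ}
  {Z : Ω → Matrix (Fin n) (Fin p) ℝ}

/-- Joint normality, beyond that of each coordinate, is what later turns zero covariance into
independence. -/
theorem hasGaussianLaw_mulVec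
    (hZ : ∀ k : Fin n × Fin p, HasLaw (fun ω => Z ω k.1 k.2) (gaussianReal 0 1) P)
    (hind : iIndepFun (fun (k : Fin n × Fin p) ω => Z ω k.1 k.2) P) (x : Fin p → ℝ) :
    HasGaussianLaw (fun ω t => (Z ω *ᵥ x) t) P := by
  have h := hind.hasGaussianLaw (fun k => (hZ k).hasGaussianLaw)
  let A : (Fin n × Fin p → ℝ) →L[ℝ] (Fin n → ℝ) :=
    ContinuousLinearMap.pi fun t => ∑ j, x j • ContinuousLinearMap.proj (t, j)
  have hA : (fun ω t => (Z ω *ᵥ x) t) = A ∘ fun ω (k : Fin n × Fin p) => Z ω k.1 k.2 := by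
    ext ω t
    simp [A, Matrix.mulVec, dotProduct, mul_comm]
  rw [hA]
  exact h.map A

theorem covariance_entries
    (hZ : ∀ k : Fin n × Fin p, HasLaw (fun ω => Z ω k.1 k.2) (gaussianReal 0 1) P)
    (hind : iIndepFun (fun (k : Fin n × Fin p) ω => Z ω k.1 k.2) P) (k l : Fin n × Fin p) :
    cov[fun ω => Z ω k.1 k.2, fun ω => Z ω l.1 l.2; P] = if k = l then 1 else 0 := by
  have := hind.isProbabilityMeasure
  have hL : ∀ k : Fin n × Fin p, MemLp (fun ω => Z ω k.1 k.2) 2 P :=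
    fun k => (hZ k).hasGaussianLaw.memLp_two
  split_ifs with h
  · subst h
    rw [covariance_self (hZ k).aemeasurable, (hZ k).variance_eq, variance_id_gaussianReal]
    simp
  · exact (hind.indepFun h).covariance_eq_zero (hL k) (hL l)

theorem covariance_mulVec
    (hZ : ∀ k : Fin n × Fin p, HasLaw (fun ω => Z ω k.1 k.2) (gaussianReal 0 1) P)
    (hind : iIndepFun (fun (k : Fin n × Fin p) ω => Z ω k.1 k.2) P) (x : Fin p → ℝ)
    (s t : Fin n) :
    cov[fun ω => (Z ω *ᵥ x) s, fun ω => (Z ω *ᵥ x) t; P] = if s = t then sqNorm x else 0 := by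
  have := hind.isProbabilityMeasure
  have hL : ∀ (t : Fin n) (j : Fin p), MemLp (fun ω => Z ω t j * x j) 2 P :=
    fun t j => ((hZ (t, j)).hasGaussianLaw.memLp_two).mul_const _
  simp only [Matrix.mulVec, dotProduct]
  rw [covariance_fun_sum_fun_sum (hL s) (hL t)]
  simp_rw [covariance_mul_const_left, covariance_mul_const_right,
    covariance_entries hZ hind (s, _) (t, _), Prod.mk.injEq]
  split_ifs with h
  · subst h
    simp [sqNorm, pow_two]
  · simp [h]

theorem iIndepFun_mulVec
    (hZ : ∀ k : Fin n × Fin p, HasLaw (fun ω => Z ω k.1 k.2) (gaussianReal 0 1) P)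
    (hind : iIndepFun (fun (k : Fin n × Fin p) ω => Z ω k.1 k.2) P) (x : Fin p → ℝ) :
    iIndepFun (fun t ω => (Z ω *ᵥ x) t) P :=
  (hasGaussianLaw_mulVec hZ hind x).iIndepFun_of_covariance_eq_zero fun s t hst => by
    rw [covariance_mulVec hZ hind, if_neg hst]

theorem hasLaw_mulVec
    (hZ : ∀ k : Fin n × Fin p, HasLaw (fun ω => Z ω k.1 k.2) (gaussianReal 0 1) P)
    (hind : iIndepFun (fun (k : Fin n × Fin p) ω => Z ω k.1 k.2) P) {x : Fin p → ℝ}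
    (hx : sqNorm x = 1) (t : Fin n) :
    HasLaw (fun ω => (Z ω *ᵥ x) t) (gaussianReal 0 1) P := by
  have := hind.isProbabilityMeasure
  have hG : HasGaussianLaw (fun ω => (Z ω *ᵥ x) t) P := (hasGaussianLaw_mulVec hZ hind x).eval t
  refine ⟨hG.aemeasurable, ?_⟩
  rw [hG.map_eq_gaussianReal]
  have hm : ∫ ω, (Z ω *ᵥ x) t ∂P = 0 := by
    simp only [Matrix.mulVec, dotProduct]
    rw [integral_finsetSum _ fun j _ => (hZ (t, j)).hasGaussianLaw.integrable.mul_const _]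
    refine Finset.sum_eq_zero fun j _ => ?_
    rw [integral_mul_const, (hZ (t, j)).integral_eq]
    simp
  have hv : Var[fun ω => (Z ω *ᵥ x) t; P] = 1 := by
    rw [← covariance_self hG.aemeasurable, covariance_mulVec hZ hind, if_pos rfl, hx]
  rw [hm, hv]
  simp

theorem sqNorm_smul {k : ℕ} (c : ℝ) (v : Fin k → ℝ) : sqNorm (c • v) = c ^ 2 * sqNorm v := by
  simp [sqNorm, mul_pow, Finset.mul_sum]

theorem sqNorm_nonneg {k : ℕ} (v : Fin k → ℝ) : 0 ≤ sqNorm v :=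
  Finset.sum_nonneg fun _ _ => sq_nonneg _

theorem sqNorm_pos {k : ℕ} {v : Fin k → ℝ} (hv : v ≠ 0) : 0 < sqNorm v := by
  obtain ⟨i, hi⟩ := Function.ne_iff.1 hv
  exact Finset.sum_pos' (fun _ _ => sq_nonneg _) ⟨i, Finset.mem_univ _, sq_pos_of_ne_zero hi⟩

theorem sqNorm_normalize {x : Fin p → ℝ} (hx : x ≠ 0) : sqNorm ((√(sqNorm x))⁻¹ • x) = 1 := by
  have := sqNorm_pos hx
  rw [sqNorm_smul, inv_pow, Real.sq_sqrt this.le, inv_mul_cancel₀ this.ne']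

theorem sqNorm_mulVec_normalize (A : Matrix (Fin n) (Fin p) ℝ) (x : Fin p → ℝ) :
    sqNorm (A *ᵥ ((√(sqNorm x))⁻¹ • x)) = sqNorm (A *ᵥ x) / sqNorm x := by
  rw [Matrix.mulVec_smul, sqNorm_smul, inv_pow, Real.sq_sqrt (sqNorm_nonneg x)]
  ring

/-- A Gaussian matrix rarely shrinks a given vector too much. -/
theorem measure_sqNorm_mulVec_lt
    (hZ : ∀ k : Fin n × Fin p, HasLaw (fun ω => Z ω k.1 k.2) (gaussianReal 0 1) P)
    (hind : iIndepFun (fun (k : Fin n × Fin p) ω => Z ω k.1 k.2) P) (x : Fin p → ℝ) :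
    P.real {ω | sqNorm (Z ω *ᵥ x) < 0.15 * n * sqNorm x} ≤ Real.exp (-0.52 * n) := by
  have := hind.isProbabilityMeasure
  -- At `x = 0` the strict inequality makes the event empty.
  obtain rfl | hx := eq_or_ne x 0
  · simpa [sqNorm] using (Real.exp_pos _).le
  refine le_trans (measureReal_mono fun ω hω => ?_)
    (measure_sum_sq_gaussianReal_le (hasLaw_mulVec hZ hind (sqNorm_normalize hx))
      (iIndepFun_mulVec hZ hind _))
  rw [Set.mem_ofPred_eq] at hω ⊢
  change sqNorm _ ≤ _
  rw [sqNorm_mulVec_normalize, div_le_iff₀ (sqNorm_pos hx)]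
  exact hω.le

/-- A Gaussian matrix rarely stretches a given vector too much. -/
theorem measure_lt_sqNorm_mulVec
    (hZ : ∀ k : Fin n × Fin p, HasLaw (fun ω => Z ω k.1 k.2) (gaussianReal 0 1) P)
    (hind : iIndepFun (fun (k : Fin n × Fin p) ω => Z ω k.1 k.2) P) (x : Fin p → ℝ) :
    P.real {ω | 4 * n * sqNorm x < sqNorm (Z ω *ᵥ x)} ≤ Real.exp (-0.52 * n) := by
  have := hind.isProbabilityMeasure
  obtain rfl | hx := eq_or_ne x 0
  · simpa [sqNorm] using (Real.exp_pos _).le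
  refine le_trans (measureReal_mono fun ω hω => ?_)
    (measure_le_sum_sq_gaussianReal (hasLaw_mulVec hZ hind (sqNorm_normalize hx))
      (iIndepFun_mulVec hZ hind _))
  rw [Set.mem_ofPred_eq] at hω ⊢
  change _ ≤ sqNorm _
  rw [sqNorm_mulVec_normalize, le_div_iff₀ (sqNorm_pos hx)]
  exact hω.le

end GaussianMatrix

/-! ### Discretization of a finite-dimensional subspace -/

/-- The points of a cubic grid in a Euclidean space, with mesh `1 / (50 k)` and coordinates in
`[-1, 1]`. -/
noncomputable def gridPoint {E : Type*} [NormedAddCommGroup E] [InnerProductSpace ℝ E] {k : ℕ}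
    (b : OrthonormalBasis (Fin k) ℝ E) (a : Fin k → Fin (100 * k + 1)) : E :=
  ∑ i, ((a i : ℝ) / (50 * k) - 1) • b i

/-- Each coordinate is rounded down to the mesh. The remainder is kept in coordinates because a
linear map is controlled only on the basis vectors. -/
theorem exists_gridPoint_close {E : Type*} [NormedAddCommGroup E] [InnerProductSpace ℝ E] {k : ℕ}
    (b : OrthonormalBasis (Fin k) ℝ E) {w : E} (hw : ‖w‖ ≤ 1) :
    ∃ a : Fin k → Fin (100 * k + 1), ∃ r : Fin k → ℝ,
      (∀ i, |r i| ≤ 1 / (50 * k)) ∧ w = gridPoint b a + ∑ i, r i • b i := by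
  have hc : ∀ i, |inner ℝ (b i) w| ≤ 1 := fun i => by
    have := abs_real_inner_le_norm (b i) w
    rw [b.norm_eq_one, one_mul] at this
    exact this.trans hw
  have hfl : ∀ i, ⌊50 * k * (inner ℝ (b i) w + 1)⌋₊ < 100 * k + 1 := fun i => by
    rw [Nat.lt_succ_iff]
    refine Nat.floor_le_of_le ?_
    have := (abs_le.1 (hc i)).2
    have hk : (0 : ℝ) ≤ k := k.cast_nonneg
    push_cast
    nlinarith
  refine ⟨fun i => ⟨_, hfl i⟩, fun i => inner ℝ (b i) w -
    ((⌊50 * k * (inner ℝ (b i) w + 1)⌋₊ : ℝ) / (50 * k) - 1), fun i => ?_, ?_⟩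
  · have hk : (0 : ℝ) < 50 * k := by
      have : 0 < k := i.pos
      positivity
    set y := 50 * (k : ℝ) * (inner ℝ (b i) w + 1) with hy
    have hy0 : 0 ≤ y := mul_nonneg hk.le (by linarith [(abs_le.1 (hc i)).1])
    have h1 := Nat.floor_le hy0
    have h2 := Nat.lt_floor_add_one y
    have h3 : inner ℝ (b i) w - ((⌊y⌋₊ : ℝ) / (50 * k) - 1) = (y - ⌊y⌋₊) / (50 * k) := by
      rw [sub_div, hy, mul_div_cancel_left₀ _ hk.ne']; ring
    change |inner ℝ (b i) w - ((⌊y⌋₊ : ℝ) / (50 * k) - 1)| ≤ _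
    rw [h3, abs_of_nonneg (div_nonneg (by linarith) hk.le)]
    gcongr
    linarith
  · rw [gridPoint, ← Finset.sum_add_distrib]
    simp_rw [← add_smul, add_sub_cancel]
    exact (b.sum_repr' w).symm

theorem norm_sum_smul_le {F : Type*} [NormedAddCommGroup F] [NormedSpace ℝ F] {k : ℕ}
    {r : Fin k → ℝ} (hr : ∀ i, |r i| ≤ 1 / (50 * k)) {y : Fin k → F} {M : ℝ} (hM : 0 ≤ M)
    (hy : ∀ i, ‖y i‖ ≤ M) : ‖∑ i, r i • y i‖ ≤ M / 50 := by
  refine (norm_sum_le_of_le _ (fun i _ => ?_ : ∀ i ∈ Finset.univ, _ ≤ 1 / (50 * k) * M)).trans ?_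
  · rw [norm_smul, Real.norm_eq_abs]
    exact mul_le_mul (hr i) (hy i) (norm_nonneg _) ((abs_nonneg _).trans (hr i))
  · rw [Finset.sum_const, Finset.card_univ, Fintype.card_fin, nsmul_eq_mul]
    obtain rfl | hk := k.eq_zero_or_pos
    · simp; positivity
    · refine le_of_eq ?_
      field_simp

/-- A linear map which is bounded on an orthonormal basis and bounded below on a grid is bounded
below. -/
theorem le_norm_map_of_grid {E F : Type*} [NormedAddCommGroup E] [InnerProductSpace ℝ E]
    [NormedAddCommGroup F] [NormedSpace ℝ F] {k : ℕ} (b : OrthonormalBasis (Fin k) ℝ E)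
    (A : E →ₗ[ℝ] F) {τ : ℝ} (hτ : 0 ≤ τ) (hb : ∀ i, ‖A (b i)‖ ≤ 2 * τ)
    (hgrid : ∀ a, 0.385 * τ * ‖gridPoint b a‖ ≤ ‖A (gridPoint b a)‖) (w : E) :
    τ / 3 * ‖w‖ ≤ ‖A w‖ := by
  have key : ∀ w : E, ‖w‖ = 1 → τ / 3 ≤ ‖A w‖ := by
    intro w hw
    obtain ⟨a, r, hr, hwa⟩ := exists_gridPoint_close b hw.le
    have h1 : ‖∑ i, r i • b i‖ ≤ 1 / 50 :=
      norm_sum_smul_le hr zero_le_one fun i => (b.norm_eq_one i).le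
    have h2 : ‖∑ i, r i • A (b i)‖ ≤ 2 * τ / 50 := norm_sum_smul_le hr (by positivity) hb
    have h3 : A w = A (gridPoint b a) + ∑ i, r i • A (b i) := by
      conv_lhs => rw [hwa]
      simp
    have h4 : 1 ≤ ‖gridPoint b a‖ + 1 / 50 := by
      have := norm_add_le (gridPoint b a) (∑ i, r i • b i)
      rw [← hwa, hw] at this
      linarith
    have h5 : ‖A (gridPoint b a)‖ - ‖∑ i, r i • A (b i)‖ ≤ ‖A w‖ := by
      rw [h3]
      exact norm_sub_le_norm_add _ _
    have h6 := hgrid a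
    -- `0.385 * (1 - 1 / 50) - 2 / 50 = 0.3373`, just above `1 / 3`.
    nlinarith [mul_le_mul_of_nonneg_left h4 hτ]
  obtain rfl | hw := eq_or_ne w 0
  · simp
  have hw' : 0 < ‖w‖ := norm_pos_iff.2 hw
  have := key (‖w‖⁻¹ • w) (by rw [norm_smul, norm_inv, norm_norm, inv_mul_cancel₀ hw'.ne'])
  rwa [map_smul, norm_smul, norm_inv, norm_norm, inv_mul_eq_div, le_div_iff₀ hw'] at this

/-! ### Spectral bounds for the covariance roots -/

/-- A lower bound for the eigenvalues of `Aᵀ A` gives a lower bound for `‖A v‖²`. -/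
theorem mul_sqNorm_le_sqNorm_mulVec {n : ℕ} {A : Matrix (Fin n) (Fin n) ℝ} {c : ℝ}
    (hA : ∀ a ∈ spectrum ℝ (Aᵀ * A), c ≤ a) (v : Fin n → ℝ) :
    c * sqNorm v ≤ sqNorm (A *ᵥ v) := by
  have hH : (Aᵀ * A - algebraMap ℝ _ c).IsHermitian := by
    refine Matrix.IsHermitian.sub ?_ ?_
    · simpa using Matrix.isHermitian_conjTranspose_mul_self A
    · rw [Algebra.algebraMap_eq_smul_one, Matrix.IsHermitian, Matrix.conjTranspose_smul]
      simp
  have hP : (Aᵀ * A - algebraMap ℝ _ c).PosSemidef := by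
    rw [hH.posSemidef_iff_eigenvalues_nonneg]
    intro i
    have := hH.eigenvalues_mem_spectrum_real i
    rw [← spectrum.sub_singleton_eq] at this
    obtain ⟨a, ha, b, rfl, hab⟩ := this
    have := hA a ha
    rw [Pi.zero_apply, ← hab]
    exact sub_nonneg.2 this
  have h := hP.dotProduct_mulVec_nonneg v
  rw [Matrix.sub_mulVec, dotProduct_sub, Algebra.algebraMap_eq_smul_one, Matrix.smul_mulVec,
    Matrix.one_mulVec, dotProduct_smul, ← Matrix.mulVec_mulVec, Matrix.dotProduct_mulVec,
    Matrix.vecMul_transpose] at h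
  simpa [sqNorm, dotProduct, pow_two] using h

/-- The temporal root satisfies `L Lᵀ = R`, whereas `‖L v‖²` involves `Lᵀ L`; the two products have
the same characteristic polynomial. -/
theorem le_spectrum_transpose_mul_self {n : ℕ} {A : Matrix (Fin n) (Fin n) ℝ} {c : ℝ}
    (hA : ∀ a ∈ spectrum ℝ (A * Aᵀ), c ≤ a) : ∀ a ∈ spectrum ℝ (Aᵀ * A), c ≤ a := by
  intro a ha
  refine hA a ?_
  rw [Matrix.mem_spectrum_iff_isRoot_charpoly] at ha ⊢
  rwa [Matrix.charpoly_mul_comm]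

/-! ### Union bound over the grid of one subspace -/

/-- A Gaussian matrix with `n` rows is bounded below by `√n / 3` on a subspace of low dimension,
with high probability. -/
theorem measure_exists_mem_sqNorm_mulVec_lt {Ω : Type*} [MeasurableSpace Ω] {P : Measure Ω}
    {n p : ℕ} {Z : Ω → Matrix (Fin n) (Fin p) ℝ}
    (hZ : ∀ k : Fin n × Fin p, HasLaw (fun ω => Z ω k.1 k.2) (gaussianReal 0 1) P)
    (hind : iIndepFun (fun (k : Fin n × Fin p) ω => Z ω k.1 k.2) P)
    (W : Submodule ℝ (Fin p → ℝ)) {m : ℕ} (hW : Module.finrank ℝ W ≤ m) :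
    P.real {ω | ∃ w ∈ W, sqNorm (Z ω *ᵥ w) < n / 9 * sqNorm w} ≤
      (m + (100 * m + 1) ^ m) * Real.exp (-0.52 * n) := by
  have := hind.isProbabilityMeasure
  -- The function space carries the sup norm, so `W` is moved to the Euclidean space to have
  -- orthonormal bases.
  let e := (WithLp.linearEquiv 2 ℝ (Fin p → ℝ)).symm
  let W' : Submodule ℝ (EuclideanSpace ℝ (Fin p)) := W.map e.toLinearMap
  set k := Module.finrank ℝ W' with hk
  have hkm : k ≤ m := by rw [hk, LinearEquiv.finrank_map_eq]; exact hW
  let b : OrthonormalBasis (Fin k) ℝ W' := stdOrthonormalBasis ℝ W'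
  have hnorm : ∀ {l : ℕ} (v : EuclideanSpace ℝ (Fin l)), sqNorm v.ofLp = ‖v‖ ^ 2 := by
    intro l v
    rw [EuclideanSpace.real_norm_sq_eq]
    rfl
  let A : Ω → W' →ₗ[ℝ] EuclideanSpace ℝ (Fin n) := fun ω =>
    (WithLp.linearEquiv 2 ℝ (Fin n → ℝ)).symm.toLinearMap ∘ₗ (Z ω).mulVecLin ∘ₗ
      (WithLp.linearEquiv 2 ℝ (Fin p → ℝ)).toLinearMap ∘ₗ W'.subtype
  have hA : ∀ ω (w : W'), ‖A ω w‖ ^ 2 = sqNorm (Z ω *ᵥ (w : EuclideanSpace ℝ (Fin p)).ofLp) :=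
    fun ω w => (hnorm _).symm
  have hsub : {ω | ∃ w ∈ W, sqNorm (Z ω *ᵥ w) < n / 9 * sqNorm w} ⊆
      (⋃ i, {ω | 4 * n * sqNorm (b i : EuclideanSpace ℝ (Fin p)).ofLp <
          sqNorm (Z ω *ᵥ (b i : EuclideanSpace ℝ (Fin p)).ofLp)}) ∪
        ⋃ a, {ω | sqNorm (Z ω *ᵥ (gridPoint b a).1.ofLp) <
          0.15 * n * sqNorm (gridPoint b a).1.ofLp} := by
    rintro ω ⟨w, hw, hlt⟩
    by_contra hω
    simp only [Set.mem_union, Set.mem_iUnion, Set.mem_ofPred_eq, not_or, not_exists, not_lt,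
      ← hA, hnorm, Submodule.norm_coe] at hω
    obtain ⟨h1, h2⟩ := hω
    have h3 := le_norm_map_of_grid b (A ω) (Real.sqrt_nonneg n) (fun i => ?_) (fun a => ?_)
      ⟨e w, Submodule.mem_map_of_mem hw⟩
    · have h4 : sqNorm w = ‖(⟨e w, Submodule.mem_map_of_mem hw⟩ : W')‖ ^ 2 := hnorm (e w)
      have h5 : sqNorm (Z ω *ᵥ w) = ‖A ω ⟨e w, Submodule.mem_map_of_mem hw⟩‖ ^ 2 :=
        (hA ω ⟨e w, Submodule.mem_map_of_mem hw⟩).symm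
      rw [h4, h5] at hlt
      have h6 := pow_le_pow_left₀ (by positivity) h3 2
      rw [mul_pow, div_pow, Real.sq_sqrt n.cast_nonneg] at h6
      norm_num at h6 hlt
      linarith
    · refine le_of_sq_le_sq ?_ (by positivity)
      rw [mul_pow, Real.sq_sqrt n.cast_nonneg]
      have := h1 i
      rw [b.norm_eq_one] at this
      linarith
    -- The constant matches because `0.385 ^ 2 ≤ 0.15`.
    · refine le_of_sq_le_sq ?_ (norm_nonneg _)
      refine le_trans ?_ (h2 a)
      rw [mul_pow, mul_pow, Real.sq_sqrt n.cast_nonneg]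
      gcongr
      norm_num
  have hnum : ((100 : ℝ) * k + 1) ^ k ≤ (100 * m + 1) ^ m :=
    (pow_le_pow_left₀ (by positivity) (by gcongr) k).trans
      (pow_le_pow_right₀ (by linarith [(m.cast_nonneg : (0 : ℝ) ≤ m)]) hkm)
  calc _ ≤ _ := measureReal_mono hsub
    _ ≤ _ := measureReal_union_le _ _
    _ ≤ ∑ i : Fin k, Real.exp (-0.52 * n) +
        ∑ a : Fin k → Fin (100 * k + 1), Real.exp (-0.52 * n) := by
      refine add_le_add ((measureReal_iUnion_fintype_le _).trans ?_)
        ((measureReal_iUnion_fintype_le _).trans ?_)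
      · exact Finset.sum_le_sum fun i _ => measure_lt_sqNorm_mulVec hZ hind _
      · exact Finset.sum_le_sum fun a _ => measure_sqNorm_mulVec_lt hZ hind _
    _ = (k + (100 * k + 1) ^ k) * Real.exp (-0.52 * n) := by
      simp [Finset.card_univ]
      ring
    _ ≤ _ := by gcongr

/-! ### Union bound over supports -/

/-- The coordinate subspace spanned by the standard basis vectors listed by `f`. -/
def coordSubspace {p m : ℕ} (f : Fin m → Fin p) : Submodule ℝ (Fin p → ℝ) :=
  Submodule.span ℝ (Set.range fun i => Pi.single (f i) (1 : ℝ))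

/-- A support of size less than `m` is listed with repetitions, so that maps `Fin m → Fin p` cover
all supports at once. -/
theorem exists_mem_coordSubspace {p m : ℕ} {v : Fin p → ℝ} (hv : v ≠ 0) (hm : zeroNorm v ≤ m) :
    ∃ f : Fin m → Fin p, v ∈ coordSubspace f := by
  classical
  let s := Finset.univ.filter fun i => v i ≠ 0
  obtain ⟨i₀, hi₀⟩ := Function.ne_iff.1 hv
  -- A nonempty support supplies the value with which `Function.invFun` fills the surplus slots.
  have : Nonempty s := ⟨i₀, by simpa [s] using hi₀⟩
  have hcard : Fintype.card s ≤ Fintype.card (Fin m) := by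
    rw [Fintype.card_coe, Fintype.card_fin]
    exact hm
  obtain ⟨g⟩ := Function.Embedding.nonempty_of_card_le hcard
  refine ⟨fun i => (Function.invFun g i : s), ?_⟩
  rw [pi_eq_sum_univ' v]
  refine Submodule.sum_mem _ fun j _ => ?_
  by_cases hj : v j = 0
  · simp [hj]
  · refine Submodule.smul_mem _ _ (Submodule.subset_span ⟨g ⟨j, by simpa [s] using hj⟩, ?_⟩)
    ext l
    simp [Function.leftInverse_invFun g.injective _, Pi.single_apply, eq_comm]

theorem finrank_map_coordSubspace_le {p m : ℕ} (f : Fin m → Fin p)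
    (A : (Fin p → ℝ) →ₗ[ℝ] Fin p → ℝ) :
    Module.finrank ℝ ((coordSubspace f).map A) ≤ m := by
  refine (Submodule.finrank_map_le _ _).trans ((finrank_range_le_card _).trans ?_)
  simp

/-- The probability that a product `L Z S` with Gaussian `Z` shrinks some sparse vector. -/
theorem measure_compl_sparseEigEvent_le {Ω : Type*} [MeasurableSpace Ω] {P : Measure Ω}
    {n p : ℕ} (hn : 0 < n) {Z : Ω → Matrix (Fin n) (Fin p) ℝ}
    (hZ : ∀ k : Fin n × Fin p, HasLaw (fun ω => Z ω k.1 k.2) (gaussianReal 0 1) P)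
    (hind : iIndepFun (fun (k : Fin n × Fin p) ω => Z ω k.1 k.2) P)
    {L : Matrix (Fin n) (Fin n) ℝ} {S : Matrix (Fin p) (Fin p) ℝ} {a b γ : ℝ} (ha : 0 ≤ a)
    (hL : ∀ y, a * sqNorm y ≤ sqNorm (L *ᵥ y)) (hS : ∀ v, b * sqNorm v ≤ sqNorm (S *ᵥ v))
    (hγ : γ ≤ b * a / 9) (m : ℕ) :
    P.real (sparseEigEvent (fun ω => L * Z ω * S) m γ)ᶜ ≤
      p ^ m * ((m + (100 * m + 1) ^ m) * Real.exp (-0.52 * n)) := by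
  have := hind.isProbabilityMeasure
  have hn' : (0 : ℝ) < n := by exact_mod_cast hn
  have hsub : (sparseEigEvent (fun ω => L * Z ω * S) m γ)ᶜ ⊆ ⋃ f : Fin m → Fin p,
      {ω | ∃ w ∈ (coordSubspace f).map S.mulVecLin,
        sqNorm (Z ω *ᵥ w) < n / 9 * sqNorm w} := by
    intro ω hω
    simp only [sparseEigEvent, Set.mem_compl_iff, Set.mem_ofPred_eq, not_forall, not_le] at hω
    obtain ⟨v, hv, hvm, hlt⟩ := hω
    obtain ⟨f, hf⟩ := exists_mem_coordSubspace hv hvm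
    refine Set.mem_iUnion.2 ⟨f, S *ᵥ v, Submodule.mem_map_of_mem (f := S.mulVecLin) hf, ?_⟩
    by_contra! hge
    have hv' := sqNorm_pos hv
    rw [div_lt_iff₀ hv', ← Matrix.mulVec_mulVec, ← Matrix.mulVec_mulVec,
      inv_mul_lt_iff₀ hn'] at hlt
    have h1 := hL (Z ω *ᵥ (S *ᵥ v))
    have h2 := mul_le_mul_of_nonneg_left hge ha
    have h3 := mul_le_mul_of_nonneg_left (hS v) (by positivity : 0 ≤ a * (n / 9))
    have h4 := mul_le_mul_of_nonneg_left hγ (by positivity : 0 ≤ n * sqNorm v)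
    linarith
  refine (measureReal_mono hsub).trans ((measureReal_iUnion_fintype_le _).trans ?_)
  refine (Finset.sum_le_sum fun f _ => measure_exists_mem_sqNorm_mulVec_lt hZ hind _
    (finrank_map_coordSubspace_le f _)).trans (le_of_eq ?_)
  simp [Finset.card_univ]

/-! ### Asymptotics of the union bound -/

/-- The excess 0.02 of 0.52 over 1/2 absorbs `(200 m + 2) ^ m`, which collects the grid count and
the `2 ^ m` from rounding `p`. Uniformity in `m` and `p` makes the threshold depend on `φ` and `δ`
alone. -/
theorem eventually_sparse_union_bound {φ δ : ℝ} (hφ : 0 < φ) (hδ : 0 < δ) :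
    ∀ᶠ T : ℕ in atTop, ∀ m p : ℕ, (m : ℝ) ≤ φ * (T : ℝ) ^ (1 - δ) →
      |(p : ℝ) - Real.exp (φ * (T : ℝ) ^ δ)| < 1 →
      (p : ℝ) ^ m * ((m + (100 * m + 1) ^ m) * Real.exp (-0.52 * T)) ≤
        2 * Real.exp (-(1 / 2 - φ ^ 2) * T) := by
  have hlog := ((isLittleO_log_rpow_atTop hδ).comp_tendsto tendsto_natCast_atTop_atTop).bound
    (show 0 < 0.01 / φ by positivity)
  filter_upwards [hlog, eventually_ge_atTop 1,
    tendsto_natCast_atTop_atTop.eventually_ge_atTop (200 * φ + 2)] with T hT hT1 hTφ m p hm hp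
  have hT1' : (1 : ℝ) ≤ T := by exact_mod_cast hT1
  have hT0 : (0 : ℝ) < T := by linarith
  have hmul : (T : ℝ) ^ (1 - δ) * (T : ℝ) ^ δ = T := by
    rw [← Real.rpow_add hT0]; simp
  have hδ0 : 0 < (T : ℝ) ^ δ := by positivity
  have hlogT : Real.log T ≤ 0.01 / φ * (T : ℝ) ^ δ := by
    have := (le_abs_self _).trans hT
    simpa [abs_of_pos hδ0] using this
  have hlogT0 : 0 ≤ Real.log T := Real.log_nonneg hT1'
  have hp2 : (p : ℝ) ≤ 2 * Real.exp (φ * (T : ℝ) ^ δ) := by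
    have h1 := (abs_lt.1 hp).2
    have h2 : 1 ≤ Real.exp (φ * (T : ℝ) ^ δ) := Real.one_le_exp (by positivity)
    linarith
  have hpm : (p : ℝ) ^ m ≤ 2 ^ m * Real.exp (φ ^ 2 * T) := by
    refine (pow_le_pow_left₀ p.cast_nonneg hp2 m).trans ?_
    rw [mul_pow, ← Real.exp_nat_mul]
    refine mul_le_mul_of_nonneg_left (Real.exp_le_exp.2 ?_) (by positivity)
    calc (m : ℝ) * (φ * (T : ℝ) ^ δ) ≤ φ * (T : ℝ) ^ (1 - δ) * (φ * (T : ℝ) ^ δ) := by gcongr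
      _ = φ ^ 2 * ((T : ℝ) ^ (1 - δ) * (T : ℝ) ^ δ) := by ring
      _ = φ ^ 2 * T := by rw [hmul]
  have hmm : (m : ℝ) ≤ (100 * m + 1) ^ m := by
    have hm0 : (0 : ℝ) ≤ m := m.cast_nonneg
    obtain rfl | hm1 := m.eq_zero_or_pos
    · simp
    · exact (by linarith : (m : ℝ) ≤ 100 * m + 1).trans
        (le_self_pow₀ (by linarith) hm1.ne')
  have hpoly : (200 * (m : ℝ) + 2) ^ m ≤ Real.exp (0.02 * T) := by
    -- By `200 * m + 2 ≤ (200 * φ + 2) * T` and the threshold `200 * φ + 2 ≤ T`.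
    have h1 : 200 * (m : ℝ) + 2 ≤ T ^ 2 := by
      have : (T : ℝ) ^ (1 - δ) ≤ T := by
        conv_rhs => rw [← Real.rpow_one (T : ℝ)]
        exact Real.rpow_le_rpow_of_exponent_le hT1' (by linarith)
      have h2 : (m : ℝ) ≤ φ * T := hm.trans (by gcongr)
      nlinarith
    have h3 : (T : ℝ) ^ 2 = Real.exp (2 * Real.log T) := by
      rw [two_mul, Real.exp_add, Real.exp_log hT0, pow_two]
    refine (pow_le_pow_left₀ (by positivity) (h1.trans h3.le) m).trans ?_
    rw [← Real.exp_nat_mul]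
    refine Real.exp_le_exp.2 ?_
    calc (m : ℝ) * (2 * Real.log T)
        ≤ φ * (T : ℝ) ^ (1 - δ) * (2 * (0.01 / φ * (T : ℝ) ^ δ)) := by gcongr
      _ = 0.02 * ((T : ℝ) ^ (1 - δ) * (T : ℝ) ^ δ) := by field_simp; norm_num
      _ = 0.02 * T := by rw [hmul]
  calc (p : ℝ) ^ m * ((m + (100 * m + 1) ^ m) * Real.exp (-0.52 * T))
      ≤ 2 ^ m * Real.exp (φ ^ 2 * T) *
          (((100 * m + 1) ^ m + (100 * m + 1) ^ m) * Real.exp (-0.52 * T)) := by gcongr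
    _ = 2 * ((200 * m + 2) ^ m * Real.exp (φ ^ 2 * T) * Real.exp (-0.52 * T)) := by
      rw [show 200 * (m : ℝ) + 2 = 2 * (100 * m + 1) by ring, mul_pow]; ring
    _ ≤ 2 * (Real.exp (0.02 * T) * Real.exp (φ ^ 2 * T) * Real.exp (-0.52 * T)) := by gcongr
    _ = 2 * Real.exp (-(1 / 2 - φ ^ 2) * T) := by
      rw [← Real.exp_add, ← Real.exp_add]
      congr 2
      ring

theorem isLittleO_of_le_mul_rpow {m : ℕ → ℕ} {φ δ : ℝ} (hδ : 0 < δ)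
    (hm : ∀ T : ℕ, 1 ≤ T → (m T : ℝ) ≤ φ * (T : ℝ) ^ (1 - δ)) :
    (fun T => (m T : ℝ)) =o[atTop] (fun T : ℕ => (T : ℝ)) := by
  have h1 : (fun T => (m T : ℝ)) =O[atTop] (fun T : ℕ => (T : ℝ) ^ (1 - δ)) := by
    refine IsBigO.of_bound φ ?_
    filter_upwards [eventually_ge_atTop 1] with T hT
    rw [Real.norm_of_nonneg (m T).cast_nonneg, Real.norm_of_nonneg (by positivity)]
    exact hm T hT
  have h2 : (fun T : ℕ => (T : ℝ) ^ (1 - δ)) =o[atTop] (fun T : ℕ => (T : ℝ)) := by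
    rw [isLittleO_iff_tendsto' ((eventually_ge_atTop 1).mono fun T hT h => by
      rw [Nat.cast_eq_zero] at h; omega)]
    refine ((tendsto_rpow_neg_atTop hδ).comp tendsto_natCast_atTop_atTop).congr' ?_
    filter_upwards [eventually_ge_atTop 1] with T hT
    have hT0 : (0 : ℝ) < T := by exact_mod_cast hT
    rw [Function.comp_apply, sub_eq_add_neg, Real.rpow_add hT0, Real.rpow_one,
      mul_div_cancel_left₀ _ hT0.ne']
  exact h1.trans_isLittleO h2

/-! ### The main result -/

theorem proposition2 (φ δ : ℝ) (hφ : φ ^ 2 < 1 / 2) :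
    ∃ T₀ : ℕ, ∀ (Ω : Type*) [MeasurableSpace Ω] (P : Measure Ω) [IsProbabilityMeasure P]
      (p s m : ℕ → ℕ) (φ₀ δ₀ cRX cRu cV : ℝ)
      (Z : ∀ T, Ω → Matrix (Fin T) (Fin (p T)) ℝ) (z : ∀ T, Ω → Fin T → ℝ)
      (RX LX Ru Lu : ∀ T : ℕ, Matrix (Fin T) (Fin T) ℝ)
      (V S : ∀ T, Matrix (Fin (p T)) (Fin (p T)) ℝ),
      Dimensionality p s φ δ φ₀ δ₀ →
      GaussianDesign P Z z RX LX Ru Lu V S cRX cRu cV →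
      (∀ T : ℕ, 1 ≤ T → (m T : ℝ) ≤ φ * (T : ℝ) ^ (1 - δ)) →
      (∀ T : ℕ, T₀ ≤ T →
        P.real (sparseEigEvent (covariate LX Z S T) (m T) (cV * min cRX cRu / 9))ᶜ
          ≤ 2 * Real.exp (-(1 / 2 - φ ^ 2) * T)) ∧
      (Tendsto m atTop atTop → ∀ μ : ℝ, μ / 2 < cV * min cRX cRu / 9 →
        RestrictedStrongConvexity P (covariate LX Z S) m μ (1 / 2 - φ ^ 2)
          (cV * min cRX cRu / 9)) := by
  -- `T₀` is chosen before `Dimensionality` is available; if either sign condition fails, that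
  -- hypothesis is contradictory.
  by_cases hpos : 0 < φ ∧ 0 < δ
  swap
  · exact ⟨0, fun Ω _ P _ p s m φ₀ δ₀ cRX cRu cV Z z RX LX Ru Lu V S hD =>
      absurd ⟨hD.φ_pos, hD.δ_pos⟩ hpos⟩
  obtain ⟨hφ0, hδ⟩ := hpos
  obtain ⟨T₁, hT₁⟩ := eventually_atTop.1 (eventually_sparse_union_bound hφ0 hδ)
  refine ⟨max T₁ 1, fun Ω _ P _ p s m φ₀ δ₀ cRX cRu cV Z z RX LX Ru Lu V S hD hG hm => ?_⟩
  have hc : 0 < cV * min cRX cRu / 9 := by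
    have := hG.rootV.c_pos
    have := lt_min hG.rootX.c_pos hG.rootu.c_pos
    positivity
  have hbound : ∀ T : ℕ, max T₁ 1 ≤ T →
      P.real (sparseEigEvent (covariate LX Z S T) (m T) (cV * min cRX cRu / 9))ᶜ
        ≤ 2 * Real.exp (-(1 / 2 - φ ^ 2) * T) := by
    intro T hT
    have hT1 : 1 ≤ T := (le_max_right _ _).trans hT
    refine le_trans ?_ (hT₁ T ((le_max_left _ _).trans hT) (m T) (p T) (hm T hT1) (hD.p_eq T hT1))
    refine measure_compl_sparseEigEvent_le (b := cV) hT1 (fun k => hG.gaussian T (Sum.inl k))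
      ((hG.indep T).precomp Sum.inl_injective) hG.rootX.c_pos.le
      (mul_sqNorm_le_sqNorm_mulVec (le_spectrum_transpose_mul_self ?_))
      (mul_sqNorm_le_sqNorm_mulVec ?_) ?_ (m T)
    · rw [hG.rootX.root]
      exact hG.rootX.le_eigenvalue T
    · rw [hG.rootV.root]
      exact hG.rootV.le_eigenvalue T
    · have := hG.rootV.c_pos
      gcongr
      exact min_le_left _ _
  refine ⟨hbound, fun hmt μ hμ => ⟨hmt, isLittleO_of_le_mul_rpow hδ hm, by linarith, hc, hμ, ?_⟩⟩
  refine IsBigO.of_bound 2 ?_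
  filter_upwards [eventually_ge_atTop (max T₁ 1)] with T hT
  rw [Real.norm_of_nonneg measureReal_nonneg, Real.norm_of_nonneg (Real.exp_pos _).le]
  exact hbound T hT
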